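/- Consider (finite, nonempty) ordered trees in which every node that has at least one child has exactly one distinguished child. For such a tree $t$ let $|t|$ be its number of nodes, and let $h(t)$ be the height of its leftmost leaf, i.e. the number of nodes on the path that starts at the root and moves to the leftmost child until it reaches a leaf, both ends included (so $h=1$ for the tree with one node). Let $$A=A(z)=\sum_t z^{|t|},\qquad F=F(z,w)=\sum_t z^{|t|}w^{h(t)},$$ the sums being over all such trees. Then, as formal power series in $z$ with coefficients in $\mathbb Z[w]$ (the denominator being invertible), $$F=\frac{zw(1-A)^2}{1-zw-2A+A^2},\qquad \frac{\partial F}{\partial w}\Big|_{w=1}=\frac{A^2}{z}.$$ Moreover, the equation $-1+3\tau-\tau^2+\tau^3=0$ has exactly one real solution $\tau$, and with $\rho=\tau/\bigl(1+\tau/(1-\tau)^2\bigr)$ the expected value of $h(t)$, for $t$ uniformly distributed over the trees with $n$ nodes, converges as $n\to\infty$ to the constant $2\tau/\rho=3.769292354\ldots$; precisely, $|2\tau/\rho-3.769292354|<5\cdot10^{-10}$. -/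

import Mathlib

open scoped Polynomial PowerSeries
open Filter Topology

/-- Ordered trees in which every node that has children has exactly one distinguished child.
A tree is either a single node, or a root whose ordered sequence of subtrees is
`l ++ d :: r`, the root of `d` being the distinguished child. -/
inductive DTree : Type
  | leaf : DTree
  | node (l : List DTree) (d : DTree) (r : List DTree) : DTree

namespace DTree

/-- The ordered list of the subtrees of the root. -/
def children : DTree → List DTree
  | leaf => []
  | node l d r => l ++ d :: r

mutual
/-- The number of nodes of a tree. -/
def size : DTree → ℕ
  | leaf => 1
  | node l d r => 1 + sizeList l + size d + sizeList r
/-- The total number of nodes of a list of trees. -/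
def sizeList : List DTree → ℕ
  | [] => 0
  | t :: ts => size t + sizeList ts
end

/-- The height of the leftmost leaf: the number of nodes on the path that starts at the root and
moves to the leftmost child until it reaches a leaf (both ends are counted). -/
def leftHeight : DTree → ℕ
  | leaf => 1
  | node [] d _ => 1 + leftHeight d
  | node (t :: _) _ _ => 1 + leftHeight t

theorem leftHeight_eq (t : DTree) :
    t.leftHeight = 1 + (t.children.head?.map leftHeight).getD 0 := by
  rcases t with _ | ⟨_ | ⟨a, l⟩, d, r⟩ <;> simp [leftHeight, children]

theorem sizeList_eq (l : List DTree) : sizeList l = (l.map size).sum := by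
  induction l with
  | nil => simp [sizeList]
  | cons t l ih => simp [sizeList, ih]

theorem size_eq (t : DTree) : t.size = 1 + (t.children.map size).sum := by
  cases t with
  | leaf => simp [size, children]
  | node l d r => simp [size, children, sizeList_eq]; ring

theorem size_pos (t : DTree) : 0 < t.size := by
  rw [size_eq]; omega

theorem length_le_sizeList (l : List DTree) : l.length ≤ sizeList l := by
  induction l with
  | nil => simp
  | cons t l ih => have := size_pos t; simp only [sizeList, List.length_cons]; omega

theorem size_le_sizeList {l : List DTree} {t : DTree} (h : t ∈ l) : t.size ≤ sizeList l := by
  rw [sizeList_eq]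
  exact List.single_le_sum (fun _ _ => Nat.zero_le _) _ (List.mem_map_of_mem h)

theorem finite_size_le (n : ℕ) : {t : DTree | t.size ≤ n}.Finite := by
  induction n with
  | zero =>
    refine Set.Finite.subset Set.finite_empty fun t ht => ?_
    have := size_pos t
    simp only [Set.mem_ofPred_eq] at ht
    omega
  | succ n ih =>
    have := ih.to_subtype
    let S := {t : DTree | t.size ≤ n}
    let f : List S × S × List S → DTree :=
      fun p => node (p.1.map (↑)) p.2.1 (p.2.2.map (↑))
    have hL : {l : List S | l.length ≤ n}.Finite := List.finite_length_le _ n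
    refine ((Set.finite_singleton leaf).union
      ((hL.prod ((Set.finite_univ (α := S)).prod hL)).image f)).subset ?_
    rintro (_ | ⟨l, d, r⟩) ht
    · exact Or.inl rfl
    · right
      simp only [Set.mem_ofPred_eq, size] at ht
      have hl := length_le_sizeList l
      have hr := length_le_sizeList r
      have hl' : ∀ t ∈ l, t ∈ S := fun t h => by
        have := size_le_sizeList h
        change t.size ≤ n
        omega
      have hr' : ∀ t ∈ r, t ∈ S := fun t h => by
        have := size_le_sizeList h
        change t.size ≤ n
        omega
      refine ⟨(l.attachWith _ hl', ⟨d, by change d.size ≤ n; omega⟩, r.attachWith _ hr'), ?_, ?_⟩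
      · simp only [Set.mem_prod, Set.mem_ofPred_eq, List.length_attachWith, Set.mem_univ, true_and]
        omega
      · simp [f]

theorem finite_size_eq (n : ℕ) : {t : DTree | t.size = n}.Finite :=
  (finite_size_le n).subset fun _ h => le_of_eq h

/-- The finite set of all trees with `n` nodes. -/
noncomputable def trees (n : ℕ) : Finset DTree := (finite_size_eq n).toFinset

theorem mem_trees {n : ℕ} {t : DTree} : t ∈ trees n ↔ t.size = n := by
  simp [trees]

/-- The generating function `A(z) = ∑ z ^ (number of nodes of t)`, over all trees `t`. Its
coefficients are regarded as constant polynomials in `w`, so that `A` lives in `ℤ[w]⟦z⟧`. -/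
noncomputable def genA : ℤ[X]⟦X⟧ := PowerSeries.mk fun n => ((trees n).card : ℤ[X])

/-- The bivariate generating function
`F(z, w) = ∑ z ^ (number of nodes of t) * w ^ (height of the leftmost leaf of t)`,
over all trees `t`, as a power series in `z` with coefficients in `ℤ[w]`. -/
noncomputable def genF : ℤ[X]⟦X⟧ :=
  PowerSeries.mk fun n => ∑ t ∈ trees n, (Polynomial.X : ℤ[X]) ^ t.leftHeight

/-- The variable `z`. -/
noncomputable def varZ : ℤ[X]⟦X⟧ := PowerSeries.X

/-- The variable `w`. -/
noncomputable def varW : ℤ[X]⟦X⟧ := PowerSeries.C Polynomial.X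

/-- The operation `G(z, w) ↦ (∂G/∂w)(z, 1)`, the resulting series in `z` being again regarded as
an element of `ℤ[w]⟦z⟧`. -/
noncomputable def derivAtOne (G : ℤ[X]⟦X⟧) : ℤ[X]⟦X⟧ :=
  PowerSeries.mk fun n =>
    Polynomial.C ((Polynomial.derivative (PowerSeries.coeff n G)).eval 1)

/-- The expected height of the leftmost leaf, all trees with `n` nodes being equally likely. -/
noncomputable def expectedLeftHeight (n : ℕ) : ℝ :=
  (∑ t ∈ trees n, (t.leftHeight : ℝ)) / ((trees n).card : ℝ)

end DTree

-- Put `L = 1/(1 - A)`, the series of lists of trees. A non-leaf root carries a list, a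
-- distinguished subtree and a list, so `A = z(1 + A L²)`. Following the leftmost path, the first
-- child is either distinguished or ordinary, so `F = zw(1 + F(L + L A L))`; as `L + L A L = L²`,
-- this is the formula for `F`. Differentiating it at `w = 1`, where `F` becomes `A`, and using the
-- equation of `A` gives `z ∂F/∂w = A²`.
--
-- Hence the mean height is `[z^(n+1)] A² / [z^n] A`. Since `A = z φ(A)` with `φ(u) = 1 + u/(1-u)²`,
-- Lagrange inversion (`lagrange_inversion`) turns both coefficients into coefficients of powers of
-- `φ`: the mean is `2n/(n+1)` times `[u^(n-1)] φ^(n+1) / [u^(n-1)] φ^n`.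
--
-- The cubic for `τ` is the saddle-point equation `τ φ'(τ) = φ(τ)`. Cauchy's formula on the circle
-- of radius `τ` and Laplace's method give `[u^(n-j)] φ^n ~ C φ(τ)^n τ^(j-n) / √n` with `C ≠ 0`
-- independent of `j` (`tendsto_sqrt_mul_coeff`). So the ratio tends to `φ(τ)`, and the mean to `2
-- φ(τ) = 2τ/ρ`.

-- Sum and product rules for weighted generating functions

section WeightedGF

variable {α β R : Type*} [CommRing R]

/-- The generating function `∑ w(a) z ^ s(a)` of a weighted class of objects. -/
noncomputable def weightedGF (s : α → ℕ) (w : α → R) : R⟦X⟧ :=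
  PowerSeries.mk fun n => ∑ᶠ a ∈ {a | s a = n}, w a

theorem coeff_weightedGF {s : α → ℕ} (hs : ∀ n, {a | s a = n}.Finite) (w : α → R) (n : ℕ) :
    PowerSeries.coeff n (weightedGF s w) = ∑ a ∈ (hs n).toFinset, w a := by
  rw [weightedGF, PowerSeries.coeff_mk, finsum_mem_eq_finite_toFinset_sum _ (hs n)]

theorem weightedGF_equiv (e : β ≃ α) (s : α → ℕ) (w : α → R) :
    weightedGF s w = weightedGF (s ∘ e) (w ∘ e) := by
  ext n
  simp only [weightedGF, PowerSeries.coeff_mk]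
  have : {a | s a = n} = e '' {b | (s ∘ e) b = n} := by
    ext a
    simp [e.image_eq_preimage_symm]
  rw [this, finsum_mem_image e.injective.injOn]
  rfl

theorem finite_fiber_inl {s : α ⊕ β → ℕ} (hs : ∀ n, {a | s a = n}.Finite) (n : ℕ) :
    {a | (s ∘ Sum.inl) a = n}.Finite :=
  (hs n).preimage Sum.inl_injective.injOn

theorem finite_fiber_inr {s : α ⊕ β → ℕ} (hs : ∀ n, {a | s a = n}.Finite) (n : ℕ) :
    {a | (s ∘ Sum.inr) a = n}.Finite :=
  (hs n).preimage Sum.inr_injective.injOn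

theorem weightedGF_sum {s : α ⊕ β → ℕ} (hs : ∀ n, {a | s a = n}.Finite) (w : α ⊕ β → R) :
    weightedGF s w = weightedGF (s ∘ Sum.inl) (w ∘ Sum.inl) +
      weightedGF (s ∘ Sum.inr) (w ∘ Sum.inr) := by
  ext n
  simp only [weightedGF, PowerSeries.coeff_mk, map_add]
  have : {a | s a = n} = Sum.inl '' {a | (s ∘ Sum.inl) a = n} ∪
      Sum.inr '' {a | (s ∘ Sum.inr) a = n} := by
    ext (a | a) <;> simp
  rw [this, finsum_mem_union Set.disjoint_image_inl_image_inr
    ((finite_fiber_inl hs n).image _) ((finite_fiber_inr hs n).image _),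
    finsum_mem_image Sum.inl_injective.injOn, finsum_mem_image Sum.inr_injective.injOn]
  rfl

theorem finite_fiber_prod {s : α → ℕ} {t : β → ℕ} (hs : ∀ n, {a | s a = n}.Finite)
    (ht : ∀ n, {b | t b = n}.Finite) (n : ℕ) : {p : α × β | s p.1 + t p.2 = n}.Finite := by
  refine Set.Finite.subset (Set.Finite.biUnion (Finset.HasAntidiagonal.antidiagonal n).finite_toSet
    fun q _ => (hs q.1).prod (ht q.2)) ?_
  rintro ⟨a, b⟩ h
  simp only [Set.mem_iUnion]
  exact ⟨(s a, t b), by simpa using h, rfl, rfl⟩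

theorem weightedGF_prod {s : α → ℕ} {t : β → ℕ} (hs : ∀ n, {a | s a = n}.Finite)
    (ht : ∀ n, {b | t b = n}.Finite) (v : α → R) (w : β → R) :
    weightedGF (fun p : α × β => s p.1 + t p.2) (fun p => v p.1 * w p.2) =
      weightedGF s v * weightedGF t w := by
  ext n
  rw [PowerSeries.coeff_mul, coeff_weightedGF (finite_fiber_prod hs ht)]
  simp only [coeff_weightedGF hs, coeff_weightedGF ht, Finset.sum_mul_sum, ← Finset.sum_product']
  rw [← Finset.sum_fiberwise_of_maps_to (t := Finset.HasAntidiagonal.antidiagonal n)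
    (g := fun p : α × β => (s p.1, t p.2)) (by simp)]
  refine Finset.sum_congr rfl fun q hq => Finset.sum_congr ?_ fun _ _ => rfl
  ext ⟨a, b⟩
  simp only [Finset.HasAntidiagonal.mem_antidiagonal] at hq
  simp only [Finset.mem_filter, Set.Finite.mem_toFinset, Set.mem_ofPred_eq, Finset.mem_product,
    Prod.ext_iff]
  constructor
  · exact fun h => h.2
  · rintro ⟨h, h'⟩
    exact ⟨by rw [h, h', hq], h, h'⟩

theorem weightedGF_unique [Unique α] (s : α → ℕ) (w : α → R) :
    weightedGF s w = PowerSeries.monomial (s default) (w default) := by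
  ext n
  rw [weightedGF, PowerSeries.coeff_mk, PowerSeries.coeff_monomial]
  by_cases h : n = s default
  · have : {a | s a = n} = {default} := by ext a; simp [Subsingleton.elim a default, h]
    rw [this, finsum_mem_singleton, if_pos h]
  · have : {a | s a = n} = ∅ := by
      ext a; simpa [Subsingleton.elim a default] using fun h' => h h'.symm
    rw [this, finsum_mem_empty, if_neg h]

theorem weightedGF_const_add {s : α → ℕ} (hs : ∀ n, {a | s a = n}.Finite) (k : ℕ) (c : R)
    (w : α → R) :
    weightedGF (fun a => k + s a) (fun a => c * w a) =
      PowerSeries.monomial k c * weightedGF s w := by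
  have h := weightedGF_prod (α := Unit) (s := fun _ => k) (fun n => Set.toFinite _) hs
    (fun _ => c) w
  rw [weightedGF_unique (α := Unit), weightedGF_equiv (Equiv.punitProd α).symm] at h
  exact h

end WeightedGF

-- Decomposition of trees and the identities for `A` and `F`

namespace DTree

theorem finite_sizeList_eq (n : ℕ) : {l : List DTree | sizeList l = n}.Finite := by
  -- Hanging the list and a distinguished leaf under a root is injective and adds two nodes.
  refine Set.Finite.of_finite_image
    (f := fun l => node l leaf []) ((finite_size_eq (n + 2)).subset ?_) ?_
  · rintro _ ⟨l, hl, rfl⟩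
    simp only [Set.mem_ofPred_eq] at hl
    simp only [Set.mem_ofPred_eq, size, sizeList]
    omega
  · intro a _ b _ h
    simpa using h

/-- A list of trees is empty, or consists of a first tree and a list of trees. -/
def listEquiv : Unit ⊕ DTree × List DTree ≃ List DTree where
  toFun
    | .inl _ => []
    | .inr (t, l) => t :: l
  invFun
    | [] => .inl ()
    | t :: l => .inr (t, l)
  left_inv := by rintro (_ | ⟨t, l⟩) <;> rfl
  right_inv := by rintro (_ | ⟨t, l⟩) <;> rfl

/-- A tree is a single node, or its leftmost subtree is the distinguished one, or its leftmost
subtree is another one. In each case the first component is the leftmost subtree. -/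
def treeEquiv : Unit ⊕ (DTree × List DTree ⊕ DTree × List DTree × DTree × List DTree) ≃ DTree where
  toFun
    | .inl _ => leaf
    | .inr (.inl (d, r)) => node [] d r
    | .inr (.inr (t, l, d, r)) => node (t :: l) d r
  invFun
    | leaf => .inl ()
    | node [] d r => .inr (.inl (d, r))
    | node (t :: l) d r => .inr (.inr (t, l, d, r))
  left_inv := by rintro (_ | ⟨_ | ⟨t, l, d, r⟩⟩) <;> rfl
  right_inv := by rintro (_ | ⟨_ | ⟨t, l⟩, d, r⟩) <;> rfl

theorem weightedGF_sizeList :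
    weightedGF sizeList (fun _ => (1 : ℤ[X])) =
      1 + weightedGF size (fun _ => 1) * weightedGF sizeList (fun _ => 1) := by
  have hf : ∀ n, {a | (sizeList ∘ listEquiv) a = n}.Finite :=
    fun n => (finite_sizeList_eq n).preimage listEquiv.injective.injOn
  conv_lhs => rw [weightedGF_equiv listEquiv, weightedGF_sum hf]
  rw [weightedGF_unique, ← weightedGF_prod finite_size_eq finite_sizeList_eq]
  congr 1
  · simp [Function.comp, listEquiv, sizeList]
  · congr 1
    funext p
    simp

/-- The weight `v` is multiplicative along the leftmost path only, so the leftmost subtree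
contributes `v` and all others contribute `1`. One proof serves both `A` (`w = 1`, `v = 1`) and `F`
(`v = X ^ leftHeight`). -/
theorem weightedGF_size (w : ℤ[X]) (v : DTree → ℤ[X]) (h0 : v leaf = w)
    (h1 : ∀ d r, v (node [] d r) = w * v d)
    (h2 : ∀ t l d r, v (node (t :: l) d r) = w * v t) :
    weightedGF size v = varZ * PowerSeries.C w * (1 + weightedGF size v *
      (weightedGF sizeList (fun _ => 1) + weightedGF sizeList (fun _ => 1) *
        weightedGF size (fun _ => 1) * weightedGF sizeList (fun _ => 1))) := by
  have hz : varZ * PowerSeries.C w = PowerSeries.monomial 1 w := by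
    rw [varZ, mul_comm, PowerSeries.X_eq, ← PowerSeries.monomial_zero_eq_C_apply,
      PowerSeries.monomial_mul_monomial]
    simp
  have hf : ∀ n, {a | (size ∘ treeEquiv) a = n}.Finite :=
    fun n => (finite_size_eq n).preimage treeEquiv.injective.injOn
  have f2 := finite_fiber_prod finite_size_eq finite_sizeList_eq
  have f3 := finite_fiber_prod finite_sizeList_eq f2
  have f4 := finite_fiber_prod finite_size_eq f3
  conv_lhs => rw [weightedGF_equiv treeEquiv, weightedGF_sum hf,
    weightedGF_sum (finite_fiber_inr hf)]
  have e1 : weightedGF (((size ∘ treeEquiv) ∘ Sum.inr) ∘ Sum.inl)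
      (((v ∘ treeEquiv) ∘ Sum.inr) ∘ Sum.inl) =
      PowerSeries.monomial 1 w * (weightedGF size v * weightedGF sizeList (fun _ => 1)) := by
    rw [← weightedGF_prod finite_size_eq finite_sizeList_eq, ← weightedGF_const_add f2]
    congr 1
    · funext ⟨d, r⟩
      simp [treeEquiv, size, sizeList, add_assoc]
    · funext ⟨d, r⟩
      simp [treeEquiv, h1]
  have e2 : weightedGF (((size ∘ treeEquiv) ∘ Sum.inr) ∘ Sum.inr)
      (((v ∘ treeEquiv) ∘ Sum.inr) ∘ Sum.inr) =
      PowerSeries.monomial 1 w * (weightedGF size v * (weightedGF sizeList (fun _ => 1) *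
        (weightedGF size (fun _ => 1) * weightedGF sizeList (fun _ => 1)))) := by
    rw [← weightedGF_prod finite_size_eq finite_sizeList_eq,
      ← weightedGF_prod finite_sizeList_eq f2, ← weightedGF_prod finite_size_eq f3,
      ← weightedGF_const_add f4]
    congr 1
    · funext ⟨t, l, d, r⟩
      simp [treeEquiv, size, sizeList, add_assoc]
    · funext ⟨t, l, d, r⟩
      simp [treeEquiv, h2]
  rw [e1, e2, hz, weightedGF_unique]
  have e0 : PowerSeries.monomial (((size ∘ treeEquiv) ∘ Sum.inl) default)
      (((v ∘ treeEquiv) ∘ Sum.inl) default) = PowerSeries.monomial 1 w := by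
    simp [treeEquiv, size, h0]
  rw [e0]
  ring

theorem genA_eq_weightedGF : genA = weightedGF size (fun _ => 1) := by
  ext1 n
  rw [coeff_weightedGF finite_size_eq]
  simp [genA, trees]

theorem genF_eq_weightedGF : genF = weightedGF size (fun t => Polynomial.X ^ t.leftHeight) := by
  ext1 n
  rw [coeff_weightedGF finite_size_eq]
  simp [genF, trees]

theorem weightedGF_sizeList_mul :
    weightedGF sizeList (fun _ => (1 : ℤ[X])) * (1 - genA) = 1 := by
  rw [genA_eq_weightedGF]
  linear_combination weightedGF_sizeList

theorem genA_mul : genA * (1 - genA) ^ 2 = varZ * ((1 - genA) ^ 2 + genA) := by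
  have h := weightedGF_size 1 (fun _ => 1) rfl (by simp) (by simp)
  have hL := weightedGF_sizeList_mul
  rw [← genA_eq_weightedGF, map_one] at h
  set L := weightedGF sizeList (fun _ => (1 : ℤ[X]))
  -- The multiple of `hL` encodes `(1 - A)²(L + L A L) = 1`, a consequence of `L(1 - A) = 1`.
  linear_combination (1 - genA) ^ 2 * h + varZ * genA * (L * (1 - genA) * genA + 1) * hL

theorem genF_mul : genF * ((1 - genA) ^ 2 - varZ * varW) = varZ * varW * (1 - genA) ^ 2 := by
  have h := weightedGF_size Polynomial.X (fun t => Polynomial.X ^ t.leftHeight)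
    (by simp [leftHeight]) (fun d r => by simp [leftHeight, pow_add])
    (fun t l d r => by simp [leftHeight, pow_add])
  have hL := weightedGF_sizeList_mul
  rw [← genA_eq_weightedGF, ← genF_eq_weightedGF] at h
  change genF = varZ * varW * _ at h
  set L := weightedGF sizeList (fun _ => (1 : ℤ[X]))
  linear_combination (1 - genA) ^ 2 * h + varZ * varW * genF * (L * (1 - genA) * genA + 1) * hL

theorem constantCoeff_genA : PowerSeries.constantCoeff genA = 0 := by
  have : trees 0 = ∅ := by
    ext t
    simpa [mem_trees] using (size_pos t).ne'
  rw [← PowerSeries.coeff_zero_eq_constantCoeff_apply, genA, PowerSeries.coeff_mk, this]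
  simp

theorem isUnit_denominator : IsUnit (1 - varZ * varW - 2 * genA + genA ^ 2) := by
  rw [PowerSeries.isUnit_iff_constantCoeff]
  simp [varZ, constantCoeff_genA]

/-- The substitution `w = 1`, the resulting series being again regarded as an element
of `ℤ[w]⟦z⟧`. -/
noncomputable def evalAtOne : ℤ[X]⟦X⟧ →+* ℤ[X]⟦X⟧ :=
  PowerSeries.map (Polynomial.C.comp (Polynomial.evalRingHom 1))

theorem coeff_evalAtOne (G : ℤ[X]⟦X⟧) (n : ℕ) :
    PowerSeries.coeff n (evalAtOne G) = Polynomial.C ((PowerSeries.coeff n G).eval 1) := by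
  simp [evalAtOne]

theorem derivAtOne_sub (G H : ℤ[X]⟦X⟧) :
    derivAtOne (G - H) = derivAtOne G - derivAtOne H := by
  ext1 n
  simp [derivAtOne]

/-- `derivAtOne` is a derivation along the ring homomorphism `evalAtOne`. It kills the series free
of `w`, which `evalAtOne` fixes, so the equation of `F` can be differentiated inside `ℤ[w]⟦z⟧`. -/
theorem derivAtOne_mul (G H : ℤ[X]⟦X⟧) :
    derivAtOne (G * H) = derivAtOne G * evalAtOne H + evalAtOne G * derivAtOne H := by
  ext1 n
  simp only [derivAtOne, PowerSeries.coeff_mk, map_add, PowerSeries.coeff_mul, coeff_evalAtOne,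
    map_sum, Polynomial.derivative_mul, Polynomial.eval_finsetSum, Polynomial.eval_add,
    Polynomial.eval_mul, ← Finset.sum_add_distrib, map_mul]

theorem derivAtOne_map_C (b : ℤ⟦X⟧) : derivAtOne (PowerSeries.map Polynomial.C b) = 0 := by
  ext1 n
  simp [derivAtOne]

theorem evalAtOne_map_C (b : ℤ⟦X⟧) :
    evalAtOne (PowerSeries.map Polynomial.C b) = PowerSeries.map Polynomial.C b := by
  ext1 n
  simp [coeff_evalAtOne]

theorem genA_eq_map :
    genA = PowerSeries.map Polynomial.C (PowerSeries.mk fun n => ((trees n).card : ℤ)) := by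
  ext1 n
  simp [genA]

theorem varZ_eq_map : varZ = PowerSeries.map Polynomial.C (PowerSeries.X : ℤ⟦X⟧) := by
  simp [varZ]

theorem derivAtOne_varW : derivAtOne varW = 1 := by
  ext1 n
  rw [derivAtOne, varW, PowerSeries.coeff_mk, PowerSeries.coeff_C, PowerSeries.coeff_one]
  split_ifs <;> simp

theorem evalAtOne_varW : evalAtOne varW = 1 := by
  simp [evalAtOne, varW]

theorem evalAtOne_genF : evalAtOne genF = genA := by
  ext1 n
  simp [coeff_evalAtOne, genF, genA, Polynomial.eval_finsetSum]

theorem varZ_mul_derivAtOne_genF : varZ * derivAtOne genF = genA ^ 2 := by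
  have hA := genA_mul
  have hB : (1 - genA) ^ 2 = PowerSeries.map Polynomial.C
      ((1 - PowerSeries.mk fun n => ((trees n).card : ℤ)) ^ 2) := by
    rw [map_pow, map_sub, ← genA_eq_map, map_one]
  have dB : derivAtOne ((1 - genA) ^ 2) = 0 := by rw [hB, derivAtOne_map_C]
  have eB : evalAtOne ((1 - genA) ^ 2) = (1 - genA) ^ 2 := by rw [hB, evalAtOne_map_C]
  have dZ : derivAtOne varZ = 0 := by rw [varZ_eq_map, derivAtOne_map_C]
  have eZ : evalAtOne varZ = varZ := by rw [varZ_eq_map, evalAtOne_map_C]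
  have h := congrArg derivAtOne genF_mul
  simp only [derivAtOne_mul, derivAtOne_sub, map_sub, map_mul, dB, eB, dZ, eZ, derivAtOne_varW,
    evalAtOne_varW, evalAtOne_genF] at h
  -- With `D` the derivative, `h` and `hA` give `D((1 - A)² - z) = A(1 - A)²`, while `hA` alone
  -- gives `A((1 - A)² - z) = z(1 - A)²`; cancelling the unit yields `zD = A²`.
  have hu : IsUnit ((1 - genA) ^ 2 - varZ) := by
    rw [PowerSeries.isUnit_iff_constantCoeff]
    simp [varZ, constantCoeff_genA]
  refine hu.mul_right_cancel ?_
  linear_combination varZ * h - (genA + varZ) * hA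

theorem coeff_derivAtOne_genF (n : ℕ) :
    PowerSeries.coeff n (derivAtOne genF) =
      Polynomial.C ((∑ t ∈ trees n, t.leftHeight : ℕ) : ℤ) := by
  simp [derivAtOne, genF, Polynomial.eval_finsetSum, Polynomial.derivative_X_pow]

/-- The generating function `A` with complex coefficients. -/
noncomputable def genAComplex : ℂ⟦X⟧ := PowerSeries.mk fun n => ((trees n).card : ℂ)

theorem map_genA :
    PowerSeries.map (Polynomial.eval₂RingHom (Int.castRingHom ℂ) 1) genA = genAComplex := by
  ext1 n
  simp [genA, genAComplex]

theorem genAComplex_mul :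
    genAComplex * (1 - genAComplex) ^ 2 =
      PowerSeries.X * ((1 - genAComplex) ^ 2 + genAComplex) := by
  have h := congrArg (PowerSeries.map (Polynomial.eval₂RingHom (Int.castRingHom ℂ) 1)) genA_mul
  simpa only [map_mul, map_pow, map_sub, map_add, map_one, map_genA, varZ, PowerSeries.map_X]
    using h

theorem expectedLeftHeight_eq (n : ℕ) :
    (expectedLeftHeight n : ℂ) =
      PowerSeries.coeff (n + 1) (genAComplex ^ 2) / PowerSeries.coeff n genAComplex := by
  have h := congrArg (fun G => PowerSeries.coeff (n + 1)
    (PowerSeries.map (Polynomial.eval₂RingHom (Int.castRingHom ℂ) 1) G)) varZ_mul_derivAtOne_genF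
  simp only [map_pow, map_genA] at h
  rw [← h, PowerSeries.coeff_map, varZ, PowerSeries.coeff_succ_X_mul, coeff_derivAtOne_genF]
  simp [expectedLeftHeight, genAComplex]

end DTree

-- Lagrange inversion by formal residues

namespace PowerSeries

variable {K : Type*} [Field K] [CharZero K]

/-- The formal change of variables in a residue: if `A = z a` with `a` invertible, then
`A ^ k * A' / a ^ n` has residue coefficient `1` for `k + 1 = n`, and `0` otherwise. -/
theorem coeff_mul_derivative_mul_inv_pow {a : K⟦X⟧} (ha : constantCoeff a ≠ 0) (n k : ℕ) :
    coeff n ((X * a) ^ k * d⁄dX K (X * a) * a⁻¹ ^ (n + 1)) = if k = n then 1 else 0 := by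
  have haa : a * a⁻¹ = 1 := PowerSeries.mul_inv_cancel a ha
  rcases lt_or_ge n k with hk | hk
  · rw [if_neg hk.ne', mul_pow, mul_assoc, mul_assoc, coeff_X_pow_mul', if_neg hk.not_ge]
  obtain ⟨m, rfl⟩ := Nat.exists_eq_add_of_le hk
  have e : (X * a) ^ k * d⁄dX K (X * a) * a⁻¹ ^ (k + m + 1) =
      X ^ k * (a⁻¹ ^ m + X * (d⁄dX K a * a⁻¹ ^ (m + 1))) := by
    have h1 : a ^ k * a⁻¹ ^ (k + m + 1) = a⁻¹ ^ (m + 1) := by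
      rw [add_assoc, pow_add, ← mul_assoc, ← mul_pow, haa, one_pow, one_mul]
    have h2 : a * a⁻¹ ^ (m + 1) = a⁻¹ ^ m := by
      rw [pow_succ', ← mul_assoc, haa, one_mul]
    rw [Derivation.leibniz, derivative_X, mul_pow, ← h2, ← h1]
    simp only [smul_eq_mul]
    ring
  rw [e, add_comm k m, coeff_X_pow_mul]
  rcases m with _ | m
  · simp
  rw [if_neg (by omega), map_add, coeff_succ_X_mul]
  -- For `n > k` the two remaining terms cancel: `a' a⁻¹ ^ (m + 2)` is `-1/(m + 1)` times the
  -- derivative of `a⁻¹ ^ (m + 1)`. Characteristic zero enters here.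
  have h := coeff_derivative (a⁻¹ ^ (m + 1)) m
  rw [derivative_pow, derivative_inv'] at h
  have e2 : ((m + 1 : ℕ) : K⟦X⟧) * a⁻¹ ^ (m + 1 - 1) * (-a⁻¹ ^ 2 * d⁄dX K a) =
      C (-((m : K) + 1)) * (d⁄dX K a * a⁻¹ ^ (m + 1 + 1)) := by
    simp only [Nat.add_sub_cancel, map_neg, map_add, map_natCast, map_one]
    push_cast
    ring
  rw [e2, coeff_C_mul] at h
  have hm : (m : K) + 1 ≠ 0 := Nat.cast_add_one_ne_zero m
  refine mul_right_cancel₀ hm ?_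
  linear_combination -h

/-- This is invariance of the residue of `G(u)/u^(n+1)` under `u = X * a`. The terms of `G` of
degree above `n` contribute nothing, so linearity reduces it to monomials. -/
theorem coeff_subst_mul_derivative_mul_inv_pow {a : K⟦X⟧} (ha : constantCoeff a ≠ 0)
    (n : ℕ) (G : K⟦X⟧) :
    coeff n (G.subst (X * a) * d⁄dX K (X * a) * a⁻¹ ^ (n + 1)) = coeff n G := by
  have hA : HasSubst (X * a : K⟦X⟧) := HasSubst.of_constantCoeff_zero' (by simp)
  have hG : G = (trunc (n + 1) G : K⟦X⟧) + X ^ (n + 1) * (mk fun i => coeff (i + (n + 1)) G) :=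
    (eq_X_pow_mul_shift_add_trunc _ _).trans (add_comm _ _)
  have hs : G.subst (X * a) = ∑ k ∈ Finset.range (n + 1), C (coeff k G) * (X * a) ^ k +
      (X * a) ^ (n + 1) * (mk fun i => coeff (i + (n + 1)) G).subst (X * a) := by
    conv_lhs => rw [hG]
    rw [subst_add hA, subst_mul hA, subst_pow hA, subst_X hA, subst_coe hA]
    congr 1
    rw [Polynomial.aeval_eq_sum_range' (n := n + 1) (natDegree_trunc_lt G n)]
    refine Finset.sum_congr rfl fun k hk => ?_
    rw [coeff_trunc, if_pos (Finset.mem_range.1 hk), smul_eq_C_mul]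
  rw [hs, add_mul, add_mul, map_add, Finset.sum_mul, Finset.sum_mul, map_sum]
  have h0 : coeff n ((X * a) ^ (n + 1) * (mk fun i => coeff (i + (n + 1)) G).subst (X * a) *
      d⁄dX K (X * a) * a⁻¹ ^ (n + 1)) = 0 := by
    rw [mul_pow, mul_assoc, mul_assoc, mul_assoc, coeff_X_pow_mul', if_neg (by omega)]
  rw [h0, add_zero, Finset.sum_eq_single n]
  · rw [mul_assoc, mul_assoc, coeff_C_mul, ← mul_assoc, coeff_mul_derivative_mul_inv_pow ha,
      if_pos rfl, mul_one]
  · intro k _ hk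
    rw [mul_assoc, mul_assoc, coeff_C_mul, ← mul_assoc, coeff_mul_derivative_mul_inv_pow ha,
      if_neg hk, mul_zero]
  · simp

/-- **Lagrange inversion**: if `A = z φ(A)` then `[z ^ n] A ^ k = (k / n) [u ^ (n - k)] φ(u) ^ n`. -/
theorem lagrange_inversion {φ A : K⟦X⟧} (hφ : constantCoeff φ ≠ 0) (hA0 : constantCoeff A = 0)
    (hA : A = X * φ.subst A) (m k : ℕ) :
    ((m + k + 1 : ℕ) : K) * coeff (m + k + 1) (A ^ (k + 1)) =
      ((k + 1 : ℕ) : K) * coeff m (φ ^ (m + k + 1)) := by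
  have hs : HasSubst A := HasSubst.of_constantCoeff_zero' hA0
  set a := φ.subst A with ha
  have hc : constantCoeff a = constantCoeff φ := by
    have h := constantCoeff_subst_eq_zero hA0 (φ - C (constantCoeff φ)) (by simp)
    rw [subst_sub hs, subst_C, ← ha, map_sub] at h
    exact (sub_eq_zero.1 h).trans (MvPowerSeries.constantCoeff_C _)
  have hac : constantCoeff a ≠ 0 := hc ▸ hφ
  -- For this `G` the powers of `a = φ(A)` cancel, leaving `A^k A'`, which is `(A^(k+1))'/(k+1)`.
  have h := coeff_subst_mul_derivative_mul_inv_pow hac (m + k) (X ^ k * φ ^ (m + k + 1))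
  rw [← hA, subst_mul hs, subst_pow hs, subst_pow hs, subst_X hs, ← ha, coeff_X_pow_mul] at h
  have haa : a ^ (m + k + 1) * a⁻¹ ^ (m + k + 1) = 1 := by
    rw [← mul_pow, PowerSeries.mul_inv_cancel a hac, one_pow]
  have e : A ^ k * a ^ (m + k + 1) * d⁄dX K A * a⁻¹ ^ (m + k + 1) = A ^ k * d⁄dX K A := by
    linear_combination A ^ k * d⁄dX K A * haa
  rw [e] at h
  have h2 := coeff_derivative (A ^ (k + 1)) (m + k)
  have e2 : d⁄dX K (A ^ (k + 1)) = C ((k + 1 : ℕ) : K) * (A ^ k * d⁄dX K A) := by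
    rw [derivative_pow, Nat.add_sub_cancel, map_natCast, mul_assoc]
  rw [e2, coeff_C_mul, h] at h2
  rw [h2]
  push_cast
  ring

end PowerSeries

-- Cauchy's coefficient formula and Laplace's method

namespace PowerSeries

/-- The power series `P` converges absolutely at `u`, with sum `v`. -/
def HasAbsSum (P : ℂ⟦X⟧) (u v : ℂ) : Prop :=
  Summable (fun n => ‖coeff n P * u ^ n‖) ∧ HasSum (fun n => coeff n P * u ^ n) v

theorem hasAbsSum_one (u : ℂ) : HasAbsSum 1 u 1 := by
  have h : ∀ n ≠ 0, coeff n (1 : ℂ⟦X⟧) * u ^ n = 0 := fun n hn => by simp [coeff_one, hn]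
  exact ⟨summable_of_ne_finset_zero (s := {0}) fun n hn => by rw [h n (by simpa using hn), norm_zero],
    by simpa using hasSum_single 0 h⟩

theorem hasAbsSum_X (u : ℂ) : HasAbsSum X u u := by
  have h : ∀ n ≠ 1, coeff n (X : ℂ⟦X⟧) * u ^ n = 0 := fun n hn => by simp [coeff_X, hn]
  exact ⟨summable_of_ne_finset_zero (s := {1}) fun n hn => by rw [h n (by simpa using hn), norm_zero],
    by simpa using hasSum_single 1 h⟩

theorem hasAbsSum_geometric {u : ℂ} (hu : ‖u‖ < 1) : HasAbsSum (mk 1) u (1 - u)⁻¹ := by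
  constructor
  · simpa using summable_geometric_of_lt_one (norm_nonneg u) hu
  · simpa using hasSum_geometric_of_norm_lt_one hu

theorem HasAbsSum.add {P Q : ℂ⟦X⟧} {u v w : ℂ} (hP : HasAbsSum P u v) (hQ : HasAbsSum Q u w) :
    HasAbsSum (P + Q) u (v + w) := by
  constructor
  · refine (hP.1.add hQ.1).of_nonneg_of_le (fun _ => norm_nonneg _) fun n => ?_
    rw [map_add, add_mul]
    exact norm_add_le _ _
  · simpa only [map_add, add_mul] using hP.2.add hQ.2

theorem HasAbsSum.mul {P Q : ℂ⟦X⟧} {u v w : ℂ} (hP : HasAbsSum P u v) (hQ : HasAbsSum Q u w) :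
    HasAbsSum (P * Q) u (v * w) := by
  have e : ∀ n, coeff n (P * Q) * u ^ n = ∑ kl ∈ Finset.HasAntidiagonal.antidiagonal n,
      (coeff kl.1 P * u ^ kl.1) * (coeff kl.2 Q * u ^ kl.2) := fun n => by
    rw [coeff_mul, Finset.sum_mul]
    refine Finset.sum_congr rfl fun kl h => ?_
    rw [← Finset.HasAntidiagonal.mem_antidiagonal.1 h, pow_add]
    ring
  have hs := summable_norm_sum_mul_antidiagonal_of_summable_norm hP.1 hQ.1
  constructor
  · simpa only [e] using hs
  · simp only [e]
    rw [← hP.2.tsum_eq, ← hQ.2.tsum_eq,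
      tsum_mul_tsum_eq_tsum_sum_antidiagonal_of_summable_norm hP.1 hQ.1]
    exact hs.of_norm.hasSum

theorem HasAbsSum.pow {P : ℂ⟦X⟧} {u v : ℂ} (hP : HasAbsSum P u v) (n : ℕ) :
    HasAbsSum (P ^ n) u (v ^ n) := by
  induction n with
  | zero => simpa using hasAbsSum_one u
  | succ n ih => simpa only [pow_succ] using ih.mul hP

theorem integral_exp_int_mul_I {k : ℤ} (hk : k ≠ 0) :
    ∫ θ in (-Real.pi)..Real.pi, Complex.exp (k * Complex.I * θ) = 0 := by
  have hc : (k : ℂ) * Complex.I ≠ 0 :=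
    mul_ne_zero (Int.cast_ne_zero.2 hk) Complex.I_ne_zero
  rw [integral_exp_mul_complex hc, div_eq_zero_iff, sub_eq_zero]
  left
  rw [Complex.exp_eq_exp_iff_exists_int]
  exact ⟨k, by push_cast; ring⟩

/-- Cauchy's formula for the coefficients of a power series that converges absolutely on the
circle of radius `r`. -/
theorem integral_eq_coeff {P : ℂ⟦X⟧} {r : ℝ} (hr : 0 ≤ r) {f : ℝ → ℂ}
    (hf : ∀ θ : ℝ, HasAbsSum P (r * Complex.exp (Complex.I * θ)) (f θ)) (m : ℕ) :
    ∫ θ in (-Real.pi)..Real.pi, f θ * Complex.exp (-(m * Complex.I * θ)) =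
      2 * Real.pi * (coeff m P * r ^ m) := by
  have hb : Summable fun n => ‖coeff n P‖ * r ^ n := by
    simpa [abs_of_nonneg hr] using (hf 0).1
  have e : ∀ (n : ℕ) (θ : ℝ), coeff n P * (r * Complex.exp (Complex.I * θ)) ^ n *
      Complex.exp (-(m * Complex.I * θ)) =
      coeff n P * r ^ n * Complex.exp (((n - m : ℤ) : ℂ) * Complex.I * θ) := fun n θ => by
    rw [mul_pow, ← Complex.exp_nat_mul, ← mul_assoc, mul_assoc _ (Complex.exp _),
      ← Complex.exp_add]
    congr 2
    push_cast
    ring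
  have h := intervalIntegral.hasSum_integral_of_dominated_convergence
    (μ := MeasureTheory.volume) (a := -Real.pi) (b := Real.pi)
    (F := fun n (θ : ℝ) => coeff n P * (r * Complex.exp (Complex.I * θ)) ^ n *
      Complex.exp (-(m * Complex.I * θ)))
    (f := fun θ => f θ * Complex.exp (-(m * Complex.I * θ)))
    (fun n _ => ‖coeff n P‖ * r ^ n)
    (fun n => Continuous.aestronglyMeasurable (by fun_prop))
    (fun n => Eventually.of_forall fun θ _ => by
      rw [e, show ((n - m : ℤ) : ℂ) * Complex.I * θ = (((n - m : ℤ) * θ : ℝ) : ℂ) * Complex.I by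
        push_cast; ring, norm_mul, Complex.norm_exp_ofReal_mul_I]
      simp [abs_of_nonneg hr])
    (Eventually.of_forall fun _ _ => hb)
    intervalIntegrable_const
    (Eventually.of_forall fun θ _ => (hf θ).2.mul_right _)
  refine h.unique ?_
  have h0 : ∀ n ≠ m, ∫ θ in (-Real.pi)..Real.pi, coeff n P * (r * Complex.exp (Complex.I * θ)) ^ n *
      Complex.exp (-(m * Complex.I * θ)) = 0 := fun n hn => by
    simp only [e]
    rw [intervalIntegral.integral_const_mul, integral_exp_int_mul_I (by omega), mul_zero]
  have hm : ∫ θ in (-Real.pi)..Real.pi, coeff m P * (r * Complex.exp (Complex.I * θ)) ^ m *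
      Complex.exp (-(m * Complex.I * θ)) = 2 * Real.pi * (coeff m P * r ^ m) := by
    simp only [e]
    simp only [sub_self, Int.cast_zero, zero_mul, Complex.exp_zero, mul_one,
      intervalIntegral.integral_const, Complex.real_smul]
    push_cast
    ring
  rw [← hm]
  exact hasSum_single m h0

end PowerSeries

/-- Laplace's method for the powers of a function on `[-π, π]` with its peak at `0`. -/
theorem tendsto_sqrt_mul_integral_pow {g h : ℝ → ℂ} (hg : Continuous g) (hh : Continuous h)
    {c s : ℝ} (hc : 0 < c) (hgc : ∀ θ, |θ| ≤ Real.pi → ‖g θ‖ ≤ Real.exp (-(c * θ ^ 2)))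
    (hh1 : ∀ θ, ‖h θ‖ ≤ 1) (hh0 : h 0 = 1) (hg0 : g 0 = 1)
    (hgs : Tendsto (fun θ : ℝ => (g θ - 1) / (θ : ℂ) ^ 2) (𝓝[≠] 0) (𝓝 (-(s : ℂ)))) :
    Tendsto (fun n : ℕ => (Real.sqrt n : ℂ) * ∫ θ in (-Real.pi)..Real.pi, g θ ^ n * h θ) atTop
      (𝓝 ((Real.sqrt (Real.pi / s) : ℝ) : ℂ)) := by
  have hpt : ∀ t : ℝ, Tendsto (fun n : ℕ => g (t / Real.sqrt n) ^ n) atTop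
      (𝓝 (Complex.exp (-s * t ^ 2))) := fun t => by
    have hlim : Tendsto (fun n : ℕ => (n : ℂ) * (g (t / Real.sqrt n) - 1)) atTop
        (𝓝 (-s * t ^ 2)) := by
      rcases eq_or_ne t 0 with rfl | ht
      · simp [hg0]
      have h1 : Tendsto (fun n : ℕ => t / Real.sqrt n) atTop (𝓝[≠] 0) := by
        refine tendsto_nhdsWithin_iff.2 ⟨?_, ?_⟩
        · exact tendsto_const_nhds.div_atTop
            (Real.tendsto_sqrt_atTop.comp tendsto_natCast_atTop_atTop)
        · filter_upwards [eventually_gt_atTop 0] with n hn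
          have : (0 : ℝ) < n := Nat.cast_pos.2 hn
          simp [ht, hn.ne']
      refine ((hgs.comp h1).mul_const ((t : ℂ) ^ 2)).congr' ?_
      filter_upwards [eventually_gt_atTop 0] with n hn
      have hn0 : (n : ℂ) ≠ 0 := Nat.cast_ne_zero.2 hn.ne'
      have ht0 : (t : ℂ) ≠ 0 := Complex.ofReal_ne_zero.2 ht
      have hsq : (Real.sqrt n : ℂ) ^ 2 = n := by
        rw [← Complex.ofReal_pow, Real.sq_sqrt (Nat.cast_nonneg n), Complex.ofReal_natCast]
      simp only [Function.comp]
      rw [Complex.ofReal_div, div_pow, hsq]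
      field_simp
    have := Complex.tendsto_one_add_pow_exp_of_tendsto hlim
    simpa using this
  -- The substitution `θ = t/√n` absorbs the factor `√n`. The indicator extends the integrand to the
  -- whole line, where `exp(-c t²)` dominates it.
  have hG : Tendsto (fun n : ℕ => ∫ t : ℝ, (Set.Ioc (-Real.pi * Real.sqrt n)
      (Real.pi * Real.sqrt n)).indicator
        (fun t => g (t / Real.sqrt n) ^ n * h (t / Real.sqrt n)) t) atTop
      (𝓝 (∫ t : ℝ, Complex.exp (-s * t ^ 2))) := by
    refine MeasureTheory.tendsto_integral_filter_of_dominated_convergence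
      (fun t => Real.exp (-c * t ^ 2)) ?_ ?_ (integrable_exp_neg_mul_sq hc) ?_
    · exact Eventually.of_forall fun n =>
        (Continuous.aestronglyMeasurable (by fun_prop)).indicator measurableSet_Ioc
    · filter_upwards [eventually_gt_atTop 0] with n hn
      refine Eventually.of_forall fun t => ?_
      have hs : 0 < Real.sqrt n := Real.sqrt_pos.2 (Nat.cast_pos.2 hn)
      rw [Set.indicator_apply]
      split_ifs with ht
      · have ht' : |t / Real.sqrt n| ≤ Real.pi := by
          rw [abs_le, le_div_iff₀ hs, div_le_iff₀ hs]
          exact ⟨ht.1.le, ht.2⟩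
        rw [norm_mul, norm_pow]
        calc ‖g (t / Real.sqrt n)‖ ^ n * ‖h (t / Real.sqrt n)‖
            ≤ Real.exp (-(c * (t / Real.sqrt n) ^ 2)) ^ n * 1 := by
              gcongr
              · exact hgc _ ht'
              · exact hh1 _
          _ = Real.exp (-c * t ^ 2) := by
              rw [mul_one, ← Real.exp_nat_mul, div_pow, Real.sq_sqrt (Nat.cast_nonneg n)]
              congr 1
              have : (n : ℝ) ≠ 0 := Nat.cast_ne_zero.2 hn.ne'
              field_simp
      · simpa using (Real.exp_pos _).le
    · refine Eventually.of_forall fun t => ?_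
      have hsq : Tendsto (fun n : ℕ => Real.sqrt n) atTop atTop :=
        Real.tendsto_sqrt_atTop.comp tendsto_natCast_atTop_atTop
      have h1 : Tendsto (fun n : ℕ => h (t / Real.sqrt n)) atTop (𝓝 1) := by
        rw [← hh0]
        exact (hh.tendsto 0).comp (tendsto_const_nhds.div_atTop hsq)
      have h2 := (hpt t).mul h1
      rw [mul_one] at h2
      refine h2.congr' ?_
      filter_upwards [hsq.eventually_gt_atTop (|t| / Real.pi)] with n hn
      rw [div_lt_iff₀ Real.pi_pos, mul_comm, abs_lt] at hn
      rw [Set.indicator_of_mem]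
      exact ⟨by linarith [hn.1], hn.2.le⟩
  have hI : ∫ t : ℝ, Complex.exp (-s * t ^ 2) = ((Real.sqrt (Real.pi / s) : ℝ) : ℂ) := by
    rw [← integral_gaussian, ← integral_complex_ofReal]
    congr 1
    funext t
    push_cast
    rfl
  rw [hI] at hG
  refine hG.congr' ?_
  filter_upwards [eventually_gt_atTop 0] with n hn
  have hs : 0 < Real.sqrt n := Real.sqrt_pos.2 (Nat.cast_pos.2 hn)
  rw [MeasureTheory.integral_indicator measurableSet_Ioc,
    ← intervalIntegral.integral_of_le (by nlinarith [Real.pi_pos]),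
    intervalIntegral.integral_comp_div (fun θ => g θ ^ n * h θ) hs.ne',
    mul_div_cancel_right₀ _ hs.ne', mul_div_cancel_right₀ _ hs.ne', Complex.real_smul]

-- Saddle-point asymptotics for the powers of `φ`

namespace DTree

/-- The series `φ(u) = 1 + u / (1 - u) ^ 2`. -/
noncomputable def phiSeries : ℂ⟦X⟧ := 1 + PowerSeries.X * PowerSeries.mk 1 ^ 2

theorem constantCoeff_phiSeries : PowerSeries.constantCoeff phiSeries = 1 := by
  simp [phiSeries]

theorem constantCoeff_genAComplex : PowerSeries.constantCoeff genAComplex = 0 := by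
  rw [← map_genA, ← PowerSeries.coeff_zero_eq_constantCoeff_apply, PowerSeries.coeff_map,
    PowerSeries.coeff_zero_eq_constantCoeff_apply, constantCoeff_genA, map_zero]

theorem genAComplex_eq : genAComplex = PowerSeries.X * phiSeries.subst genAComplex := by
  have hs : PowerSeries.HasSubst genAComplex :=
    PowerSeries.HasSubst.of_constantCoeff_zero' constantCoeff_genAComplex
  have hL : (PowerSeries.mk 1 : ℂ⟦X⟧).subst genAComplex * (1 - genAComplex) = 1 := by
    have h := congrArg (PowerSeries.subst genAComplex) (PowerSeries.mk_one_mul_one_sub_eq_one ℂ)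
    rwa [PowerSeries.subst_mul hs, PowerSeries.subst_sub hs, PowerSeries.subst_X hs,
      ← PowerSeries.coe_substAlgHom hs, map_one, PowerSeries.coe_substAlgHom hs] at h
  have hp : phiSeries.subst genAComplex =
      1 + genAComplex * (PowerSeries.mk 1 : ℂ⟦X⟧).subst genAComplex ^ 2 := by
    rw [phiSeries, PowerSeries.subst_add hs, PowerSeries.subst_mul hs, PowerSeries.subst_pow hs,
      PowerSeries.subst_X hs, ← PowerSeries.coe_substAlgHom hs, map_one]
  have hA := genAComplex_mul
  rw [hp]
  set L := (PowerSeries.mk 1 : ℂ⟦X⟧).subst genAComplex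
  linear_combination L ^ 2 * hA + (PowerSeries.X - genAComplex) * (L * (1 - genAComplex) + 1) * hL

/-- The function `φ(u) = 1 + u / (1 - u) ^ 2`. -/
noncomputable def phi {K : Type*} [Field K] (u : K) : K := 1 + u / (1 - u) ^ 2

theorem hasAbsSum_phiSeries {u : ℂ} (hu : ‖u‖ < 1) : phiSeries.HasAbsSum u (phi u) := by
  have h := (PowerSeries.hasAbsSum_one u).add
    ((PowerSeries.hasAbsSum_X u).mul ((PowerSeries.hasAbsSum_geometric hu).pow 2))
  rwa [inv_pow, ← div_eq_mul_inv] at h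

theorem norm_ofReal_mul_exp {r : ℝ} (hr : 0 ≤ r) (θ : ℝ) :
    ‖(r : ℂ) * Complex.exp (Complex.I * θ)‖ = r := by
  rw [mul_comm Complex.I, norm_mul, Complex.norm_exp_ofReal_mul_I, mul_one, Complex.norm_real,
    Real.norm_of_nonneg hr]

theorem one_sub_ne_zero {u : ℂ} (hu : ‖u‖ < 1) : 1 - u ≠ 0 := by
  intro h
  rw [← sub_eq_zero.1 h, norm_one] at hu
  exact lt_irrefl _ hu

theorem one_sub_norm_le (u : ℂ) : 1 - ‖u‖ ≤ ‖1 - u‖ := by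
  simpa using norm_sub_norm_le (1 : ℂ) u

/-- The series `φ(u) - (1 + u)` has nonnegative coefficients, so its modulus is at most its value at
`‖u‖`. The whole gain over `φ(‖u‖)` is kept in the explicit term `1 + u`. -/
theorem norm_phi_le {u : ℂ} (hu : ‖u‖ < 1) : ‖phi u‖ ≤ phi ‖u‖ + ‖1 + u‖ - (1 + ‖u‖) := by
  have h1 : 1 - u ≠ 0 := one_sub_ne_zero hu
  have h2 : 0 < 1 - ‖u‖ := by linarith
  have e : phi u = (1 + u) + (u * (u / (1 - u) ^ 2) + u * (u / (1 - u))) := by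
    unfold phi
    field_simp
    ring
  have e' : phi ‖u‖ = (1 + ‖u‖) +
      (‖u‖ * (‖u‖ / (1 - ‖u‖) ^ 2) + ‖u‖ * (‖u‖ / (1 - ‖u‖))) := by
    unfold phi
    have := h2.ne'
    field_simp
    ring
  have h3 := one_sub_norm_le u
  have h4 : ‖u * (u / (1 - u) ^ 2) + u * (u / (1 - u))‖ ≤
      ‖u‖ * (‖u‖ / (1 - ‖u‖) ^ 2) + ‖u‖ * (‖u‖ / (1 - ‖u‖)) := by
    refine (norm_add_le _ _).trans ?_
    simp only [norm_mul, norm_div, norm_pow]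
    gcongr
  rw [e, e']
  linarith [norm_add_le (1 + u) (u * (u / (1 - u) ^ 2) + u * (u / (1 - u)))]

theorem norm_one_add_mul_exp_le {r : ℝ} (hr : 0 < r) {θ : ℝ} (hθ : |θ| ≤ Real.pi) :
    ‖1 + r * Complex.exp (Complex.I * θ)‖ ≤
      1 + r - 2 * r / (Real.pi ^ 2 * (1 + r)) * θ ^ 2 := by
  have hcos := Real.cos_le_one_sub_mul_cos_sq hθ
  have hpi := Real.pi_pos
  have hsq : ‖1 + r * Complex.exp (Complex.I * θ)‖ ^ 2 =
      (1 + r) ^ 2 - 2 * r * (1 - Real.cos θ) := by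
    rw [mul_comm Complex.I, ← Complex.normSq_eq_norm_sq, Complex.normSq_apply]
    simp [Complex.exp_ofReal_mul_I_re, Complex.exp_ofReal_mul_I_im]
    linear_combination r ^ 2 * Real.sin_sq_add_cos_sq θ
  set N := ‖1 + r * Complex.exp (Complex.I * θ)‖
  have hx : 2 * r / (Real.pi ^ 2 * (1 + r)) * θ ^ 2 =
      r * (2 / Real.pi ^ 2 * θ ^ 2) / (1 + r) := by
    field_simp
  have h1 : r * (2 / Real.pi ^ 2 * θ ^ 2) ≤ r * (1 - Real.cos θ) := by
    gcongr
    linarith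
  have h2 : N ≤ 1 + r - r * (1 - Real.cos θ) / (1 + r) := by
    have h3 : (1 + r) * N ≤ (1 + r) ^ 2 - r * (1 - Real.cos θ) := by
      -- The inequality `2(1 + r)N ≤ N² + (1 + r)²` avoids a square root.
      nlinarith [sq_nonneg (N - (1 + r))]
    have h4 : 1 + r - r * (1 - Real.cos θ) / (1 + r) =
        ((1 + r) ^ 2 - r * (1 - Real.cos θ)) / (1 + r) := by
      field_simp
    rw [h4, le_div_iff₀ (by linarith)]
    linarith
  rw [hx]
  have h5 : r * (2 / Real.pi ^ 2 * θ ^ 2) / (1 + r) ≤ r * (1 - Real.cos θ) / (1 + r) := by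
    gcongr
  linarith

section Asymptotics

variable {τ : ℝ}

theorem phi_pos (h0 : 0 < τ) : 0 < phi τ := by
  unfold phi
  positivity

/-- The characteristic function `φ(τ exp(i θ)) exp(- i θ) / φ(τ)`. -/
noncomputable def charFn (τ θ : ℝ) : ℂ :=
  phi (τ * Complex.exp (Complex.I * θ)) * Complex.exp (-(Complex.I * θ)) / (phi τ : ℝ)

theorem continuous_charFn (h0 : 0 < τ) (h1 : τ < 1) : Continuous (charFn τ) := by
  unfold charFn phi
  have h : ∀ θ : ℝ, (1 - τ * Complex.exp (Complex.I * θ)) ^ 2 ≠ 0 := fun θ =>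
    pow_ne_zero 2 (one_sub_ne_zero (by rwa [norm_ofReal_mul_exp h0.le]))
  fun_prop (disch := exact h)

theorem charFn_zero (h0 : 0 < τ) : charFn τ 0 = 1 := by
  have h : ((phi τ : ℝ) : ℂ) ≠ 0 := Complex.ofReal_ne_zero.2 (phi_pos h0).ne'
  rw [charFn, div_eq_one_iff_eq h]
  simp [phi]

theorem norm_charFn_le (h0 : 0 < τ) (h1 : τ < 1) {θ : ℝ} (hθ : |θ| ≤ Real.pi) :
    ‖charFn τ θ‖ ≤ Real.exp (-(2 * τ / (Real.pi ^ 2 * (1 + τ)) / phi τ * θ ^ 2)) := by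
  have hp := phi_pos h0
  have hu := norm_ofReal_mul_exp h0.le θ
  have h2 := norm_phi_le (u := τ * Complex.exp (Complex.I * θ)) (by rwa [hu])
  rw [hu] at h2
  have h3 := norm_one_add_mul_exp_le h0 hθ
  have h4 : ‖Complex.exp (-(Complex.I * θ))‖ = 1 := by
    rw [show -(Complex.I * (θ : ℂ)) = ((-θ : ℝ) : ℂ) * Complex.I by push_cast; ring,
      Complex.norm_exp_ofReal_mul_I]
  rw [charFn, norm_div, norm_mul, h4, mul_one, Complex.norm_real, Real.norm_of_nonneg hp.le]
  refine le_trans ?_ (Real.one_sub_le_exp_neg _)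
  rw [div_le_iff₀ hp]
  have h5 : (1 - 2 * τ / (Real.pi ^ 2 * (1 + τ)) / phi τ * θ ^ 2) * phi τ =
      phi τ - 2 * τ / (Real.pi ^ 2 * (1 + τ)) * θ ^ 2 := by
    field_simp
  rw [h5]
  linarith

/-- Half of the variance of the distribution with characteristic function `charFn τ`. -/
noncomputable def halfVar (τ : ℝ) : ℝ :=
  ((1 - τ) ^ 2 - τ ^ 2 * ((1 - τ) ^ 2 + τ)) / ((1 - τ) ^ 4 * phi τ)

theorem halfVar_pos (h0 : 0 < τ) (h1 : τ < 1 / 2) : 0 < halfVar τ := by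
  have hp := phi_pos h0
  have h2 : 0 < 1 - τ := by linarith
  refine div_pos ?_ (by positivity)
  -- The numerator is `(1 - τ)²(1 - τ²) - τ³`. Positivity makes the constant of the local limit
  -- theorem nonzero.
  nlinarith [mul_pos h0 h0, mul_pos h0 h2, mul_pos h2 (sub_pos.2 h1), mul_pos h0 (sub_pos.2 h1)]

/-- The saddle-point equation removes the linear term at `θ = 0`, so `exp(iθ) - 1` divides twice. As
`(exp(iθ) - 1)/θ → i`, the cofactor at `θ = 0` is `halfVar τ`. -/
theorem charFn_sub_one (h0 : 0 < τ) (h1 : τ < 1) (hτ : -1 + 3 * τ - τ ^ 2 + τ ^ 3 = 0) (θ : ℝ) :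
    charFn τ θ - 1 = (Complex.exp (Complex.I * θ) - 1) ^ 2 *
      (((1 - τ) ^ 2 - τ ^ 2 * ((1 - τ) ^ 2 + τ) * Complex.exp (Complex.I * θ)) /
        (Complex.exp (Complex.I * θ) * (1 - τ * Complex.exp (Complex.I * θ)) ^ 2 *
          (1 - τ) ^ 2 * (phi τ : ℝ))) := by
  have hp : ((phi τ : ℝ) : ℂ) ≠ 0 := Complex.ofReal_ne_zero.2 (phi_pos h0).ne'
  have h2 : 1 - τ * Complex.exp (Complex.I * θ) ≠ 0 :=
    one_sub_ne_zero (by rwa [norm_ofReal_mul_exp h0.le])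
  have h3 : (1 : ℂ) - τ ≠ 0 := by
    rw [← Complex.ofReal_one, ← Complex.ofReal_sub]
    exact Complex.ofReal_ne_zero.2 (by linarith)
  have h4 := Complex.exp_ne_zero (Complex.I * θ)
  have hτ' : -1 + 3 * (τ : ℂ) - τ ^ 2 + τ ^ 3 = 0 := by exact_mod_cast congrArg Complex.ofReal hτ
  have hphi : ((phi τ : ℝ) : ℂ) * (1 - τ) ^ 2 = (1 - τ) ^ 2 + τ := by
    have : ((phi τ : ℝ) : ℂ) = 1 + τ / (1 - τ) ^ 2 := by simp [phi]
    rw [this]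
    field_simp
  rw [charFn, Complex.exp_neg, phi]
  set x := Complex.exp (Complex.I * θ)
  set p := ((phi τ : ℝ) : ℂ)
  set t := (τ : ℂ)
  field_simp
  linear_combination (1 - t) * (x ^ 2 - x) * hτ' - x * (1 - t * x) ^ 2 * hphi

theorem tendsto_charFn_sub_one_div (h0 : 0 < τ) (h1 : τ < 1)
    (hτ : -1 + 3 * τ - τ ^ 2 + τ ^ 3 = 0) :
    Tendsto (fun θ : ℝ => (charFn τ θ - 1) / (θ : ℂ) ^ 2) (𝓝[≠] 0) (𝓝 (-(halfVar τ : ℂ))) := by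
  have hd : HasDerivAt (fun θ : ℝ => Complex.exp (Complex.I * θ)) Complex.I 0 := by
    have h := ((Complex.ofRealCLM.hasDerivAt (x := (0 : ℝ))).const_mul Complex.I).cexp
    simpa using h
  have hs := hd.tendsto_slope_zero
  have hp : ((phi τ : ℝ) : ℂ) ≠ 0 := Complex.ofReal_ne_zero.2 (phi_pos h0).ne'
  have h3 : (1 : ℂ) - τ ≠ 0 := by
    rw [← Complex.ofReal_one, ← Complex.ofReal_sub]
    exact Complex.ofReal_ne_zero.2 (by linarith)
  have hc : ContinuousAt (fun θ : ℝ =>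
      ((1 - τ) ^ 2 - τ ^ 2 * ((1 - τ) ^ 2 + τ) * Complex.exp (Complex.I * θ)) /
        (Complex.exp (Complex.I * θ) * (1 - τ * Complex.exp (Complex.I * θ)) ^ 2 *
          (1 - τ) ^ 2 * (phi τ : ℝ))) 0 := by
    refine ContinuousAt.div (by fun_prop) (by fun_prop) ?_
    simp [hp, h3]
  have h := (hs.pow 2).mul (hc.tendsto.mono_left nhdsWithin_le_nhds)
  have hv : Complex.I ^ 2 * (((1 - τ) ^ 2 - τ ^ 2 * ((1 - τ) ^ 2 + τ) *
      Complex.exp (Complex.I * (0 : ℝ))) / (Complex.exp (Complex.I * (0 : ℝ)) *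
      (1 - τ * Complex.exp (Complex.I * (0 : ℝ))) ^ 2 * (1 - τ) ^ 2 * (phi τ : ℝ))) =
      -(halfVar τ : ℂ) := by
    simp only [halfVar, Complex.ofReal_zero, mul_zero, Complex.exp_zero, Complex.I_sq]
    push_cast
    field_simp
  rw [hv] at h
  refine h.congr fun θ => ?_
  rw [charFn_sub_one h0 h1 hτ]
  simp only [zero_add, Complex.ofReal_zero, mul_zero, Complex.exp_zero, Complex.real_smul,
    Complex.ofReal_inv, mul_pow, inv_pow]
  ring

/-- The local limit theorem for the coefficients of the powers of `φ`. -/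
theorem tendsto_sqrt_mul_coeff (h0 : 0 < τ) (h1 : τ < 1 / 2)
    (hτ : -1 + 3 * τ - τ ^ 2 + τ ^ 3 = 0) (j : ℕ) :
    Tendsto (fun n : ℕ => (Real.sqrt n : ℂ) * (PowerSeries.coeff (n - j) (phiSeries ^ n) *
      (τ : ℂ) ^ (n - j) / ((phi τ : ℝ) : ℂ) ^ n)) atTop
      (𝓝 (((Real.sqrt (Real.pi / halfVar τ) : ℝ) : ℂ) / (2 * Real.pi))) := by
  have h1' : τ < 1 := by linarith
  have hp := phi_pos h0
  have hp' : ((phi τ : ℝ) : ℂ) ≠ 0 := Complex.ofReal_ne_zero.2 hp.ne'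
  have hpi : (2 * Real.pi : ℂ) ≠ 0 := by simp [Real.pi_ne_zero]
  -- The shift `j` enters only through the fixed factor `exp(ijθ)`, equal to `1` at the peak, so it
  -- does not affect the limit.
  have h := (tendsto_sqrt_mul_integral_pow (h := fun θ => Complex.exp ((j * θ : ℝ) * Complex.I))
    (continuous_charFn h0 h1') (by fun_prop) (c := 2 * τ / (Real.pi ^ 2 * (1 + τ)) / phi τ)
    (by have := Real.pi_pos; positivity) (fun θ => norm_charFn_le h0 h1')
    (fun θ => (Complex.norm_exp_ofReal_mul_I _).le) (by simp) (charFn_zero h0)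
    (tendsto_charFn_sub_one_div h0 h1' hτ)).div_const (2 * Real.pi : ℂ)
  refine h.congr' ?_
  filter_upwards [eventually_ge_atTop j] with n hn
  have hc := PowerSeries.integral_eq_coeff h0.le (fun θ => (hasAbsSum_phiSeries
    (u := τ * Complex.exp (Complex.I * θ)) (by rwa [norm_ofReal_mul_exp h0.le])).pow n) (n - j)
  have he : ∀ θ : ℝ, charFn τ θ ^ n * Complex.exp ((j * θ : ℝ) * Complex.I) =
      phi (τ * Complex.exp (Complex.I * θ)) ^ n *
        Complex.exp (-((n - j : ℕ) * Complex.I * θ)) / ((phi τ : ℝ) : ℂ) ^ n := fun θ => by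
    rw [charFn, div_pow, mul_pow, ← Complex.exp_nat_mul, div_mul_eq_mul_div, mul_assoc,
      ← Complex.exp_add, Nat.cast_sub hn]
    congr 3
    push_cast
    ring
  simp only [he]
  rw [intervalIntegral.integral_div, hc]
  field_simp

theorem tendsto_coeff_ratio (h0 : 0 < τ) (h1 : τ < 1 / 2)
    (hτ : -1 + 3 * τ - τ ^ 2 + τ ^ 3 = 0) :
    Tendsto (fun n : ℕ => PowerSeries.coeff n (phiSeries ^ (n + 2)) /
      PowerSeries.coeff n (phiSeries ^ (n + 1))) atTop (𝓝 ((phi τ : ℝ) : ℂ)) := by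
  have hp' : ((phi τ : ℝ) : ℂ) ≠ 0 := Complex.ofReal_ne_zero.2 (phi_pos h0).ne'
  have hτ0 : (τ : ℂ) ≠ 0 := Complex.ofReal_ne_zero.2 h0.ne'
  have hl : ((Real.sqrt (Real.pi / halfVar τ) : ℝ) : ℂ) / (2 * Real.pi) ≠ 0 := by
    have := Real.sqrt_pos.2 (div_pos Real.pi_pos (halfVar_pos h0 h1))
    refine div_ne_zero (Complex.ofReal_ne_zero.2 this.ne') (by simp [Real.pi_ne_zero])
  -- Shifts `2` and `1` at exponents `n + 2` and `n + 1` both select the coefficient of index `n`,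
  -- with the same power of `τ`.
  have ha := (tendsto_sqrt_mul_coeff h0 h1 hτ 2).comp (tendsto_add_atTop_nat 2)
  have hb := (tendsto_sqrt_mul_coeff h0 h1 hτ 1).comp (tendsto_add_atTop_nat 1)
  have hr : Tendsto (fun n : ℕ => ((Real.sqrt ((n + 1 : ℕ) / (n + 2 : ℕ)) : ℝ) : ℂ)) atTop
      (𝓝 ((Real.sqrt 1 : ℝ) : ℂ)) := by
    refine ((Complex.continuous_ofReal.comp Real.continuous_sqrt).tendsto 1).comp ?_
    have := (tendsto_natCast_div_add_atTop (1 : ℝ)).comp (tendsto_add_atTop_nat 1)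
    refine this.congr fun n => ?_
    simp only [Function.comp]
    push_cast
    ring
  have h := ((ha.div hb hl).mul hr).mul_const ((phi τ : ℝ) : ℂ)
  rw [div_self hl, Real.sqrt_one, Complex.ofReal_one, one_mul, one_mul] at h
  refine h.congr fun n => ?_
  have e1 : ((Real.sqrt (n + 1 : ℕ) : ℝ) : ℂ) ≠ 0 :=
    Complex.ofReal_ne_zero.2 (Real.sqrt_pos.2 (by positivity)).ne'
  have e2 : ((Real.sqrt (n + 2 : ℕ) : ℝ) : ℂ) ≠ 0 :=
    Complex.ofReal_ne_zero.2 (Real.sqrt_pos.2 (by positivity)).ne'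
  simp only [Function.comp, Nat.add_sub_cancel, Pi.div_apply]
  rw [Real.sqrt_div (by positivity), Complex.ofReal_div]
  -- If the denominator vanishes, both sides are `0` by the convention for division, so no
  -- nonvanishing proof is needed.
  by_cases hz : PowerSeries.coeff n (phiSeries ^ (n + 1)) = 0
  · simp [hz]
  field_simp
  ring

theorem tendsto_expectedLeftHeight (h0 : 0 < τ) (h1 : τ < 1 / 2)
    (hτ : -1 + 3 * τ - τ ^ 2 + τ ^ 3 = 0) :
    Tendsto expectedLeftHeight atTop (𝓝 (2 * phi τ)) := by
  rw [← tendsto_add_atTop_iff_nat 1, ← tendsto_ofReal_iff]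
  have hr : Tendsto (fun n : ℕ => (((n + 1 : ℕ) / (n + 2 : ℕ) : ℝ) : ℂ)) atTop
      (𝓝 ((1 : ℝ) : ℂ)) := by
    refine (Complex.continuous_ofReal.tendsto 1).comp ?_
    have := (tendsto_natCast_div_add_atTop (1 : ℝ)).comp (tendsto_add_atTop_nat 1)
    refine this.congr fun n => ?_
    simp only [Function.comp]
    push_cast
    ring
  have h := ((tendsto_coeff_ratio h0 h1 hτ).mul hr).const_mul 2
  rw [Complex.ofReal_one, mul_one] at h
  rw [Complex.ofReal_mul, Complex.ofReal_ofNat]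
  refine h.congr fun n => ?_
  have hφ : PowerSeries.constantCoeff phiSeries ≠ 0 := by simp [constantCoeff_phiSeries]
  have l1 := PowerSeries.lagrange_inversion hφ constantCoeff_genAComplex genAComplex_eq n 0
  have l2 := PowerSeries.lagrange_inversion hφ constantCoeff_genAComplex genAComplex_eq n 1
  have n1 : ((n : ℂ) + 1) ≠ 0 := Nat.cast_add_one_ne_zero n
  have n2 : ((n : ℂ) + 2) ≠ 0 := by exact_mod_cast (Nat.succ_ne_zero (n + 1))
  simp only [add_zero, zero_add, pow_one, Nat.cast_one, one_mul] at l1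
  norm_num [add_assoc] at l1 l2
  rw [expectedLeftHeight_eq, ← l1]
  have l2' : PowerSeries.coeff (n + 1 + 1) (genAComplex ^ 2) =
      2 * PowerSeries.coeff n (phiSeries ^ (n + 2)) / (n + 2) := by
    rw [← l2]
    field_simp
  rw [l2']
  push_cast
  field_simp

end Asymptotics

-- Location of the root and the numerical value

theorem exists_root_mem_Ioo :
    ∃ τ : ℝ, 0.36110308052 < τ ∧ τ < 0.36110308054 ∧
      ∀ x : ℝ, -1 + 3 * x - x ^ 2 + x ^ 3 = 0 ↔ x = τ := by
  have hc : ContinuousOn (fun x : ℝ => -1 + 3 * x - x ^ 2 + x ^ 3)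
      (Set.Icc 0.36110308052 0.36110308054) := by fun_prop
  obtain ⟨τ, ⟨h1, h2⟩, hτ⟩ := intermediate_value_Ioo (by norm_num) hc
    (show (0 : ℝ) ∈ _ by constructor <;> norm_num)
  refine ⟨τ, h1, h2, fun x => ⟨fun hx => ?_, fun hx => hx ▸ hτ⟩⟩
  have h : (x - τ) * (3 - (x + τ) + x ^ 2 + x * τ + τ ^ 2) = 0 := by
    linear_combination hx - hτ
  -- The quadratic cofactor is `((x + τ - 1)² + x² + τ² + 5)/2`.
  have hpos : 0 < 3 - (x + τ) + x ^ 2 + x * τ + τ ^ 2 := by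
    nlinarith [sq_nonneg (x + τ - 1), sq_nonneg x, sq_nonneg τ]
  exact sub_eq_zero.1 ((mul_eq_zero.1 h).resolve_right hpos.ne')

theorem abs_two_mul_phi_sub_lt {τ : ℝ} (h1 : 0.36110308052 < τ) (h2 : τ < 0.36110308054) :
    |2 * phi τ - 3.769292354| < 5 / (10 : ℝ) ^ 10 := by
  have h3 : (0 : ℝ) < 1 - τ := by linarith
  -- `u/(1 - u)²` increases on `(0, 1)`, so its values at the ends of the interval for `τ` suffice.
  have hl : (0.36110308052 : ℝ) / (1 - 0.36110308052) ^ 2 ≤ τ / (1 - τ) ^ 2 := by gcongr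
  have hu : τ / (1 - τ) ^ 2 ≤ (0.36110308054 : ℝ) / (1 - 0.36110308054) ^ 2 := by gcongr
  norm_num at hl hu
  rw [abs_lt, phi]
  constructor <;> norm_num <;> linarith

end DTree

theorem mainTheorem6 :
    (IsUnit (1 - DTree.varZ * DTree.varW - 2 * DTree.genA + DTree.genA ^ 2) ∧
      DTree.genF * (1 - DTree.varZ * DTree.varW - 2 * DTree.genA + DTree.genA ^ 2) =
        DTree.varZ * DTree.varW * (1 - DTree.genA) ^ 2) ∧
    DTree.varZ * DTree.derivAtOne DTree.genF = DTree.genA ^ 2 ∧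
    ∃ τ ρ : ℝ,
      (∀ x : ℝ, -1 + 3 * x - x ^ 2 + x ^ 3 = 0 ↔ x = τ) ∧
      ρ = τ / (1 + τ / (1 - τ) ^ 2) ∧
      Tendsto DTree.expectedLeftHeight atTop (𝓝 (2 * τ / ρ)) ∧
      |2 * τ / ρ - 3.769292354| < 5 / (10 : ℝ) ^ 10 := by
  obtain ⟨τ, h1, h2, hτ⟩ := DTree.exists_root_mem_Ioo
  have h0 : 0 < τ := lt_trans (by norm_num) h1
  have hr : 2 * τ / (τ / (1 + τ / (1 - τ) ^ 2)) = 2 * DTree.phi τ := by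
    have := (DTree.phi_pos h0).ne'
    change 2 * τ / (τ / DTree.phi τ) = _
    field_simp
  refine ⟨⟨DTree.isUnit_denominator, ?_⟩, DTree.varZ_mul_derivAtOne_genF, τ, _, hτ, rfl, ?_, ?_⟩
  · linear_combination DTree.genF_mul
  · rw [hr]
    exact DTree.tendsto_expectedLeftHeight h0 (h2.trans (by norm_num)) ((hτ τ).2 rfl)
  · rw [hr]
    exact DTree.abs_two_mul_phi_sub_lt h1 h2
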